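/- Let $\varepsilon\in(0,1)$ and put $$\Gamma_\varepsilon=\frac{\pi}{2\sqrt2\,\bigl(\cos((1-\varepsilon)\tfrac{\pi}{2})\bigr)^{1/4}}.$$ Then $\Gamma_\varepsilon>0$, and the following holds. Let $\kappa>0$ and $D_\kappa=\pi/\sqrt\kappa$, let $(X,d)$ be a complete $\mathrm{CAT}(\kappa)$ space, and let $B=\overline B_r(o)\subset X$ be a closed ball of radius $r\le (1-\varepsilon)D_\kappa/4$. Here $\mathrm{CAT}(\kappa)$ means: any two points of $X$ at distance less than $D_\kappa$ are joined by a geodesic, and in every geodesic triangle of $X$ of perimeter less than $2D_\kappa$ the distance between any two points of the triangle is at most the distance between the corresponding points of a comparison triangle in the two-dimensional sphere of constant curvature $\kappa$. Let $\mathcal P_2(B)$ be the set of Borel probability measures on $B$ with finite second moment. For $\mu_1,\mu_2\in\mathcal P_2(B)$ let $$W_2(\mu_1,\mu_2)=\inf_{\pi}\Bigl(\int_{B\times B} d(x,y)^2\,d\pi(x,y)\Bigr)^{1/2},$$ where $\pi$ runs over the Borel measures on $B\times B$ with marginals $\mu_1$ and $\mu_2$ (and $\inf\emptyset=\infty$).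 Then every $\mu\in\mathcal P_2(B)$ has a barycenter $\mathfrak B(\mu)\in B$, that is, the function $z\mapsto\int_B d(z,x)^2\,d\mu(x)$ on $B$ has a unique minimizer $\mathfrak B(\mu)$; and for all $\mu_1,\mu_2\in\mathcal P_2(B)$, $$d(\mathfrak B(\mu_1),\mathfrak B(\mu_2))\le \Gamma_\varepsilon\, W_2(\mu_1,\mu_2).$$ -/

import Mathlib

open MeasureTheory
open scoped ENNReal

noncomputable section

/-- With respect to the distance function `d`, the curve `γ` (used only on `[0, 1]`) is a geodesic
connecting `x` and `y`: it has constant speed `c ≥ 0`, starts at `x` and ends at `y`. -/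
def IsGeodesicFromTo {Y : Type*} (d : Y → Y → ℝ) (γ : ℝ → Y) (x y : Y) : Prop :=
  γ 0 = x ∧ γ 1 = y ∧
    ∃ c : ℝ, 0 ≤ c ∧ ∀ s ∈ Set.Icc (0 : ℝ) 1, ∀ t ∈ Set.Icc (0 : ℝ) 1,
      d (γ s) (γ t) = c * |s - t|

/-- The diameter `D_κ = π / √κ` of the model plane of constant curvature `κ > 0`. -/
def modelDiam (κ : ℝ) : ℝ := Real.pi / Real.sqrt κ

/-- The underlying set of the model plane of constant curvature `κ > 0`: the unit sphere in
Euclidean 3-space. -/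
abbrev ModelPlane : Type := Metric.sphere (0 : EuclideanSpace ℝ (Fin 3)) 1

/-- The distance of the model plane of constant curvature `κ > 0`: the angular (great-circle)
distance on the unit sphere, divided by `√κ`. -/
def modelDist (κ : ℝ) (u v : ModelPlane) : ℝ :=
  InnerProductGeometry.angle (u : EuclideanSpace ℝ (Fin 3)) (v : EuclideanSpace ℝ (Fin 3)) /
    Real.sqrt κ

/-- A triangle with vertices `p 0, p 1, p 2` and with sides `σ 0, σ 1, σ 2`, where `σ i` is a
geodesic connecting `p i` and `p (i + 1)` (indices modulo 3), with respect to the distance `d`. -/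
def IsGeodesicTriangle {Y : Type*} (d : Y → Y → ℝ) (p : Fin 3 → Y) (σ : Fin 3 → ℝ → Y) : Prop :=
  ∀ i, IsGeodesicFromTo d (σ i) (p i) (p (i + 1))

/-- `X` is a `CAT(κ)` space, for `κ > 0`: any two points at distance less than `D_κ` are connected
by a geodesic, and in each geodesic triangle of perimeter less than `2 D_κ` distances between
points of the triangle are at most the distances between the corresponding points of a comparison
triangle in the model plane. The point `σ i s` corresponds to the point `σ' i s`. -/
def IsCAT (κ : ℝ) (X : Type*) [MetricSpace X] : Prop :=
  (∀ x y : X, dist x y < modelDiam κ → ∃ γ : ℝ → X, IsGeodesicFromTo dist γ x y) ∧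
  ∀ (p : Fin 3 → X) (σ : Fin 3 → ℝ → X), IsGeodesicTriangle dist p σ →
    ∑ i, dist (p i) (p (i + 1)) < 2 * modelDiam κ →
    ∀ (p' : Fin 3 → ModelPlane) (σ' : Fin 3 → ℝ → ModelPlane),
      IsGeodesicTriangle (modelDist κ) p' σ' →
      (∀ i, modelDist κ (p' i) (p' (i + 1)) = dist (p i) (p (i + 1))) →
      ∀ i j, ∀ s ∈ Set.Icc (0 : ℝ) 1, ∀ t ∈ Set.Icc (0 : ℝ) 1,
        dist (σ i s) (σ j t) ≤ modelDist κ (σ' i s) (σ' j t)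

/-- `μ ∈ P₂(Y)`: a Borel probability measure with finite second moment. -/
def MemP2 {Y : Type*} [MetricSpace Y] [MeasurableSpace Y] [BorelSpace Y] (μ : Measure Y) : Prop :=
  IsProbabilityMeasure μ ∧ ∃ z : Y, ∫⁻ x, edist z x ^ 2 ∂μ < ∞

/-- `π` is a Borel measure on `Y × Y` with marginals `μ` and `ν`. The Borel σ-algebra of the
product is used (without separability it can be larger than the product σ-algebra). -/
def IsCoupling {Y : Type*} [MetricSpace Y] [MeasurableSpace Y] [BorelSpace Y]
    (π : @Measure (Y × Y) (borel (Y × Y))) (μ ν : Measure Y) : Prop :=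
  @Measure.map (Y × Y) Y (borel (Y × Y)) _ Prod.fst π = μ ∧
    @Measure.map (Y × Y) Y (borel (Y × Y)) _ Prod.snd π = ν

/-- The Wasserstein-2 distance, with the infimum taken in `[0, ∞]`. -/
def W2 {Y : Type*} [MetricSpace Y] [MeasurableSpace Y] [BorelSpace Y] (μ ν : Measure Y) : ℝ≥0∞ :=
  ⨅ (π : @Measure (Y × Y) (borel (Y × Y))) (_ : IsCoupling π μ ν),
    (@lintegral (Y × Y) (borel (Y × Y)) π (fun q => edist q.1 q.2 ^ 2)) ^ (1 / 2 : ℝ)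

/-- `b` is a barycenter of `μ`: a minimizer over `Y` of `z ↦ ∫ d(z, x)² dμ(x)`. -/
def IsBarycenter {Y : Type*} [MetricSpace Y] [MeasurableSpace Y] [BorelSpace Y]
    (μ : Measure Y) (b : Y) : Prop :=
  ∀ z : Y, ∫⁻ x, edist b x ^ 2 ∂μ ≤ ∫⁻ x, edist z x ^ 2 ∂μ

/-- The Lipschitz constant `Γ_ε`. -/
def Gam (ε : ℝ) : ℝ :=
  Real.pi / (2 * Real.sqrt 2 * (Real.cos ((1 - ε) * (Real.pi / 2))) ^ (1 / 4 : ℝ))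

end

/-!
Write `k = √κ` and `a = (1 - ε) π / 2 < π / 2`. Scaled by `k`, the ball `B` has radius at most
`a / 2`, so that only angles up to `a` occur; below,
`d` is the scaled distance. The `CAT(κ)` condition says that the Euclidean cone
over `B` is nonpositively curved. It is used only in the form `HasConeCombinations`: the geodesic
from `x` to `z` contains a point `p` such that `h • p` behaves like `α • x + β • z`, where inner
products in the cone are products of heights with `cos (k * dist p q)`.

Midpoints (`α = β = 1`) make the squared distance functions uniformly convex, which gives existence
and uniqueness of barycenters. The combinations `b + β • z` with `β → 0` give the first variation
`∫ w(ρ) (cos d(x, z) - cos ρ cos d(b, z)) dμ(x) ≤ 0` at a barycenter `b`, where `ρ = d(b, x)` and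
`w(ρ) = ρ / sin ρ` (`HasConeCombinations.firstVariation`).

Let `ν` be a coupling of `μ₁` and `μ₂` with barycenters `b₁` and `b₂`, and let `s = w(d(b₁, x))` and
`t = w(d(b₂, y))`. The first variations at `b₁` towards `b₂` and at `b₂` towards `b₁` are added, and
the cross terms are bounded by the quadrilateral inequality in the cone for `x`, `y`, `t • b₁`,
`s • b₂` (`HasConeCombinations.quadrilateral`). With this choice of heights, the
error `(t - s)²` caused by unequal weights is dominated by a term of favourable sign, since
`w + cos` is decreasing. For the chord `q = 2 sin (d(b₁, b₂) / 2)` the result is `q² S² ≤ V P`, where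
`S = ½ ∫ (s cos d(b₁, x) + t cos d(b₂, y)) dν`, `P = ∫ s t dν`, and `V ≤ ∫ d(x, y)² dν` is the
integral of the squared chords.

The first variation towards the center of the ball gives `S ≥ cos (a / 2) m` with
`m = ½ ∫ (s + t) dν`, and since the weights lie in `[1, M]` with `M = w(a)`, Kantorovich's
inequality gives `P ≤ (1 + M)² / (4 M) m²`. From `M² cos a ≤ 1` one obtains `q² ≤ V / √(cos a)`
(`HasConeCombinations.chord_sq_le`), and `d(b₁, b₂) ≤ π q / (2√2)` finishes the proof.
-/

section BarycenterContraction

open Real Set Filter Topology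

/-! ### Trigonometric inequalities -/

/-- The weight `ρ / sin ρ`, written as the inverse of `sinc` so that its value at `0` is `1`, as
continuity demands. Half the derivative of `ρ²` with respect to `-cos ρ` is this weight. -/
noncomputable def sincInv (ρ : ℝ) : ℝ := (sinc ρ)⁻¹

theorem sinc_pos_of_mem {ρ : ℝ} (h0 : 0 ≤ ρ) (h1 : ρ ≤ π / 2) : 0 < sinc ρ := by
  rcases h0.eq_or_lt with rfl | h0
  · simp
  · rw [sinc_of_ne_zero h0.ne']
    exact div_pos (sin_pos_of_pos_of_lt_pi h0 (by linarith [pi_pos])) h0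

theorem sincInv_of_ne_zero {ρ : ℝ} (h : ρ ≠ 0) : sincInv ρ = ρ / sin ρ := by
  rw [sincInv, sinc_of_ne_zero h, inv_div]

theorem sincInv_mul_sin {ρ : ℝ} (h0 : 0 ≤ ρ) (h1 : ρ ≤ π / 2) : sincInv ρ * sin ρ = ρ := by
  rcases h0.eq_or_lt with rfl | h0
  · simp
  · rw [sincInv_of_ne_zero h0.ne', div_mul_cancel₀]
    exact (sin_pos_of_pos_of_lt_pi h0 (by linarith [pi_pos])).ne'

theorem continuousOn_sincInv : ContinuousOn sincInv (Icc 0 (π / 2)) :=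
  continuous_sinc.continuousOn.inv₀ fun _ h => (sinc_pos_of_mem h.1 h.2).ne'

theorem hasDerivAt_sincInv {ρ : ℝ} (h0 : 0 < ρ) (h1 : ρ < π / 2) :
    HasDerivAt sincInv ((sin ρ - ρ * cos ρ) / sin ρ ^ 2) ρ := by
  have hs : sin ρ ≠ 0 := (sin_pos_of_pos_of_lt_pi h0 (by linarith [pi_pos])).ne'
  have h := (hasDerivAt_id ρ).div (hasDerivAt_sin ρ) hs
  simp only [id, one_mul] at h
  refine h.congr_of_eventuallyEq ?_
  filter_upwards [lt_mem_nhds h0] with x hx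
  simp [sincInv_of_ne_zero hx.ne']

theorem mul_cos_le_sin {ρ : ℝ} (h0 : 0 ≤ ρ) (h1 : ρ < π / 2) : ρ * cos ρ ≤ sin ρ := by
  have hc : 0 < cos ρ := cos_pos_of_mem_Ioo ⟨by linarith [pi_pos], h1⟩
  have := le_tan h0 h1
  rwa [tan_eq_sin_div_cos, le_div_iff₀ hc] at this

theorem monotoneOn_sincInv : MonotoneOn sincInv (Icc 0 (π / 2)) := by
  refine monotoneOn_of_deriv_nonneg (convex_Icc _ _) continuousOn_sincInv ?_ ?_
  · rw [interior_Icc]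
    exact fun x hx => (hasDerivAt_sincInv hx.1 hx.2).differentiableAt.differentiableWithinAt
  · rw [interior_Icc]
    intro x hx
    rw [(hasDerivAt_sincInv hx.1 hx.2).deriv]
    exact div_nonneg (by linarith [mul_cos_le_sin hx.1.le hx.2]) (sq_nonneg _)

theorem antitoneOn_sincInv_add_cos : AntitoneOn (fun ρ => sincInv ρ + cos ρ) (Icc 0 (π / 2)) := by
  have hd : ∀ x ∈ Ioo 0 (π / 2), HasDerivAt (fun ρ => sincInv ρ + cos ρ)
      ((sin x - x * cos x) / sin x ^ 2 + -sin x) x := fun x hx =>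
    (hasDerivAt_sincInv hx.1 hx.2).add (hasDerivAt_cos x)
  refine antitoneOn_of_deriv_nonpos (convex_Icc _ _)
    (continuousOn_sincInv.add continuous_cos.continuousOn) ?_ ?_
  · rw [interior_Icc]
    exact fun x hx => (hd x hx).differentiableAt.differentiableWithinAt
  · rw [interior_Icc]
    intro x hx
    rw [(hd x hx).deriv]
    have hs : 0 < sin x := sin_pos_of_pos_of_lt_pi hx.1 (by linarith [pi_pos, hx.2])
    have hc : 0 < cos x := cos_pos_of_mem_Ioo ⟨by linarith [pi_pos, hx.1], hx.2⟩
    have h1 : sin x * cos x ≤ x := by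
      nlinarith [sin_le hx.1.le, cos_le_one x]
    have : (sin x - x * cos x) / sin x ^ 2 ≤ sin x := by
      rw [div_le_iff₀ (by positivity)]
      have h2 := sin_sq_add_cos_sq x
      nlinarith [mul_le_mul_of_nonneg_right h1 hc.le]
    linarith

theorem one_le_sincInv {ρ : ℝ} (h0 : 0 ≤ ρ) (h1 : ρ ≤ π / 2) : 1 ≤ sincInv ρ := by
  have := monotoneOn_sincInv (left_mem_Icc.2 (by positivity)) ⟨h0, h1⟩ h0
  simpa [sincInv] using this

/-- Replacing `cos ρ` by the weight `ρ / sin ρ` shrinks differences and reverses their sign. In the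
main estimate this absorbs the error caused by the two barycenters seeing their coupled points at
different distances, hence with different weights. -/
theorem sq_sincInv_sub_le {ρ σ : ℝ} (hρ : ρ ∈ Icc 0 (π / 2)) (hσ : σ ∈ Icc 0 (π / 2)) :
    (sincInv σ - sincInv ρ) ^ 2 ≤ (sincInv σ - sincInv ρ) * (cos ρ - cos σ) := by
  rcases le_total ρ σ with h | h
  · have h1 := monotoneOn_sincInv hρ hσ h
    have h2 := antitoneOn_sincInv_add_cos hρ hσ h
    simp only at h2
    nlinarith
  · have h1 := monotoneOn_sincInv hσ hρ h
    have h2 := antitoneOn_sincInv_add_cos hσ hρ h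
    simp only at h2
    nlinarith

/-- As a function of `cos ρ`, the square `ρ²` is convex with slope `-2ρ / sin ρ`; this is the
tangent line inequality at `cos ρ`. -/
theorem sq_le_sq_add_sincInv_mul {ρ σ : ℝ} (hρ : ρ ∈ Icc 0 (π / 2)) (hσ : σ ∈ Icc 0 (π / 2)) :
    ρ ^ 2 ≤ σ ^ 2 + 2 * sincInv ρ * (cos σ - cos ρ) := by
  have hd : ∀ x, HasDerivAt (fun x => x ^ 2 + 2 * sincInv ρ * cos x)
      (2 * x + 2 * sincInv ρ * -sin x) x := fun x => by
    have := (hasDerivAt_pow 2 x).add ((hasDerivAt_cos x).const_mul (2 * sincInv ρ))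
    simp only [Nat.cast_ofNat, Nat.add_one_sub_one, pow_one] at this
    exact this
  have hc : Continuous (fun x => x ^ 2 + 2 * sincInv ρ * cos x) := by fun_prop
  have hs : ∀ x ∈ Icc 0 (π / 2), 0 ≤ sin x := fun x hx =>
    sin_nonneg_of_nonneg_of_le_pi hx.1 (by linarith [pi_pos, hx.2])
  suffices ρ ^ 2 + 2 * sincInv ρ * cos ρ ≤ σ ^ 2 + 2 * sincInv ρ * cos σ by linarith
  rcases le_total ρ σ with h | h
  · refine (monotoneOn_of_deriv_nonneg (convex_Icc ρ (π / 2)) hc.continuousOn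
      (fun x _ => (hd x).differentiableAt.differentiableWithinAt) ?_)
      (left_mem_Icc.2 hρ.2) ⟨h, hσ.2⟩ h
    rw [interior_Icc]
    intro x hx
    have hx' : x ∈ Icc 0 (π / 2) := ⟨hρ.1.trans hx.1.le, hx.2.le⟩
    rw [(hd x).deriv]
    have := mul_le_mul_of_nonneg_right (monotoneOn_sincInv hρ hx' hx.1.le) (hs x hx')
    rw [sincInv_mul_sin hx'.1 hx'.2] at this
    linarith
  · refine (antitoneOn_of_deriv_nonpos (convex_Icc 0 ρ) hc.continuousOn
      (fun x _ => (hd x).differentiableAt.differentiableWithinAt) ?_)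
      ⟨hσ.1, h⟩ (right_mem_Icc.2 hρ.1) h
    rw [interior_Icc]
    intro x hx
    have hx' : x ∈ Icc 0 (π / 2) := ⟨hx.1.le, hx.2.le.trans hρ.2⟩
    rw [(hd x).deriv]
    have := mul_le_mul_of_nonneg_right (monotoneOn_sincInv hx' hρ hx.2.le) (hs x hx')
    rw [sincInv_mul_sin hx'.1 hx'.2] at this
    linarith

/-- Proved by passing to the half angle, where `tan (a / 2) ≥ a / 2` suffices because
`cos a ≤ cos (a / 2) ^ 4`. -/
theorem sincInv_sq_mul_cos_le_one {a : ℝ} (h0 : 0 ≤ a) (h1 : a < π / 2) :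
    sincInv a ^ 2 * cos a ≤ 1 := by
  rcases h0.eq_or_lt with rfl | h0
  · simp [sincInv]
  have hs : 0 < sin a := sin_pos_of_pos_of_lt_pi h0 (by linarith [pi_pos])
  have hc : 0 < cos a := cos_pos_of_mem_Ioo ⟨by linarith, h1⟩
  rw [sincInv_of_ne_zero h0.ne', div_pow, div_mul_eq_mul_div, div_le_one (by positivity)]
  have hS : sin a = 2 * sin (a / 2) * cos (a / 2) := by rw [← sin_two_mul]; ring_nf
  have hC : cos a = 2 * cos (a / 2) ^ 2 - 1 := by rw [← cos_two_mul]; ring_nf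
  have ht := mul_cos_le_sin (ρ := a / 2) (by linarith) (by linarith)
  have hc2 : 0 < cos (a / 2) := cos_pos_of_mem_Ioo ⟨by linarith, by linarith⟩
  set C := cos (a / 2)
  set S := sin (a / 2)
  have h4 : cos a ≤ C ^ 4 := by rw [hC]; nlinarith [sq_nonneg (C ^ 2 - 1)]
  calc a ^ 2 * cos a ≤ a ^ 2 * C ^ 4 := by gcongr
    _ = (a / 2 * C) ^ 2 * (4 * C ^ 2) := by ring
    _ ≤ S ^ 2 * (4 * C ^ 2) := by gcongr
    _ = sin a ^ 2 := by rw [hS]; ring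

/-- The left side is the constant in the Kantorovich inequality for a random variable with values in
`[1, M]`. -/
theorem kantorovich_le {M c : ℝ} (hM : 1 ≤ M) (hc : 0 < c) (h : M ^ 2 * c ≤ 1) :
    (1 + M) ^ 2 / (4 * M) ≤ (1 + c) / (2 * √c) := by
  have hu : 0 < √c := sqrt_pos.2 hc
  have hu2 : √c ^ 2 = c := sq_sqrt hc.le
  set u := √c
  rw [← hu2] at h ⊢
  have hMu : M * u ≤ 1 := by
    rw [← mul_pow] at h
    exact (sq_le_one_iff₀ (by positivity)).1 h
  rw [div_le_div_iff₀ (by positivity) (by positivity)]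
  have h1 : u * (1 + M ^ 2) ≤ M * (1 + u ^ 2) := by
    have hu1 : u ≤ M := by nlinarith
    nlinarith [mul_nonneg (sub_nonneg.2 hMu) (sub_nonneg.2 hu1)]
  nlinarith [mul_nonneg hu.le (sq_nonneg (M - 1))]

/-- An angle `D ≤ π / 2` is at most `π / (2√2)` times the chord `2 sin (D / 2)`. -/
theorem sq_le_chord_sq {D : ℝ} (h0 : 0 ≤ D) (h1 : D ≤ π / 2) :
    D ^ 2 ≤ π ^ 2 / 8 * (2 - 2 * cos D) := by
  have h := monotoneOn_sincInv (a := D / 2) (b := π / 4) ⟨by linarith, by linarith⟩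
    ⟨by positivity, by linarith [pi_pos]⟩ (by linarith)
  have hs := sin_nonneg_of_nonneg_of_le_pi (x := D / 2) (by linarith) (by linarith)
  have h2 := mul_le_mul_of_nonneg_right h hs
  rw [sincInv_mul_sin (by linarith) (by linarith), sincInv_of_ne_zero (by positivity),
    sin_pi_div_four] at h2
  have hC : cos D = 1 - 2 * sin (D / 2) ^ 2 := by
    have := cos_two_mul' (D / 2)
    rw [show 2 * (D / 2) = D by ring] at this
    nlinarith [sin_sq_add_cos_sq (D / 2)]
  have h3 := pow_le_pow_left₀ (by linarith) h2 2
  have hs2 : √2 ^ 2 = (2 : ℝ) := sq_sqrt (by norm_num)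
  rw [mul_pow, div_pow, div_pow, div_pow, div_pow, hs2] at h3
  rw [hC]
  linarith

/-! ### Comparison triangles and cone combinations -/

theorem ModelPlane.norm_eq (u : ModelPlane) : ‖(u : EuclideanSpace ℝ (Fin 3))‖ = 1 :=
  mem_sphere_zero_iff_norm.1 u.2

theorem ModelPlane.cos_angle (u v : ModelPlane) :
    cos (InnerProductGeometry.angle (u : EuclideanSpace ℝ (Fin 3)) v) =
      inner ℝ (u : EuclideanSpace ℝ (Fin 3)) v := by
  rw [InnerProductGeometry.cos_angle, u.norm_eq, v.norm_eq]; simp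

/-- Spherical linear interpolation is a geodesic of the model plane. The interpolation formula is
multiplied by `sin θ`, so that it also covers the constant geodesic `θ = 0`. -/
theorem ModelPlane.exists_geodesic (κ : ℝ) (u v : ModelPlane) {θ : ℝ}
    (hθ : InnerProductGeometry.angle (u : EuclideanSpace ℝ (Fin 3)) v = θ) (hπ : θ < π) :
    ∃ σ : ℝ → ModelPlane, IsGeodesicFromTo (modelDist κ) σ u v ∧ ∀ t,
      sin θ • (σ t : EuclideanSpace ℝ (Fin 3)) =
        sin ((1 - t) * θ) • (u : EuclideanSpace ℝ (Fin 3)) +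
          sin (t * θ) • (v : EuclideanSpace ℝ (Fin 3)) := by
  have hθ0 : 0 ≤ θ := hθ ▸ InnerProductGeometry.angle_nonneg _ _
  have hin : inner ℝ (u : EuclideanSpace ℝ (Fin 3)) v = cos θ := by
    rw [← hθ, ModelPlane.cos_angle]
  have huu : inner ℝ (u : EuclideanSpace ℝ (Fin 3)) u = 1 := by
    rw [real_inner_self_eq_norm_sq, u.norm_eq]; norm_num
  have hvv : inner ℝ (v : EuclideanSpace ℝ (Fin 3)) v = 1 := by
    rw [real_inner_self_eq_norm_sq, v.norm_eq]; norm_num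
  rcases hθ0.eq_or_lt with h0 | h0
  · have huv : u = v := by
      apply Subtype.ext
      rw [← h0, cos_zero] at hin
      exact (inner_eq_one_iff_of_norm_eq_one u.norm_eq v.norm_eq).1 hin
    subst huv
    refine ⟨fun _ => u, ⟨rfl, rfl, 0, le_rfl, fun s _ t _ => ?_⟩, fun t => ?_⟩
    · rw [modelDist, hθ, ← h0]; simp
    · rw [← h0]; simp
  · have hs : 0 < sin θ := sin_pos_of_pos_of_lt_pi h0 hπ
    set e : EuclideanSpace ℝ (Fin 3) :=
      (sin θ)⁻¹ • ((v : EuclideanSpace ℝ (Fin 3)) - cos θ • (u : EuclideanSpace ℝ (Fin 3))) with he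
    have hue : inner ℝ (u : EuclideanSpace ℝ (Fin 3)) e = 0 := by
      rw [he, inner_smul_right, inner_sub_right, inner_smul_right, hin, huu]; ring
    have hee : inner ℝ e e = 1 := by
      rw [he, inner_smul_right, inner_smul_left, inner_sub_right, inner_sub_left, inner_sub_left,
        inner_smul_right, inner_smul_left, inner_smul_left, inner_smul_right, hin, huu, hvv,
        real_inner_comm, hin]
      simp only [RCLike.conj_to_real]
      field_simp
      nlinarith [sin_sq_add_cos_sq θ]
    have hσ : ∀ s t : ℝ, inner ℝ (cos s • (u : EuclideanSpace ℝ (Fin 3)) + sin s • e)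
        (cos t • (u : EuclideanSpace ℝ (Fin 3)) + sin t • e) = cos (s - t) := by
      intro s t
      simp only [inner_add_left, inner_add_right, inner_smul_left, inner_smul_right, huu, hue, hee,
        real_inner_comm (u : EuclideanSpace ℝ (Fin 3)) e, RCLike.conj_to_real, cos_sub]
      ring
    have hn : ∀ t, cos (t * θ) • (u : EuclideanSpace ℝ (Fin 3)) + sin (t * θ) • e ∈
        Metric.sphere (0 : EuclideanSpace ℝ (Fin 3)) 1 := by
      intro t
      rw [mem_sphere_zero_iff_norm, norm_eq_sqrt_real_inner, hσ]; simp
    refine ⟨fun t => ⟨_, hn t⟩, ⟨?_, ?_, θ / √κ, by positivity, ?_⟩, ?_⟩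
    · apply Subtype.ext; simp
    · apply Subtype.ext
      simp only [one_mul, he, smul_smul, mul_inv_cancel₀ hs.ne', one_smul]
      abel
    · intro s hs t ht
      have hab : |s - t| ≤ 1 := abs_sub_le_iff.2 ⟨by linarith [hs.2, ht.1], by linarith [ht.2, hs.1]⟩
      rw [modelDist]
      have : InnerProductGeometry.angle
          (cos (s * θ) • (u : EuclideanSpace ℝ (Fin 3)) + sin (s * θ) • e)
          (cos (t * θ) • (u : EuclideanSpace ℝ (Fin 3)) + sin (t * θ) • e) = θ * |s - t| := by
        rw [InnerProductGeometry.angle, hσ, mem_sphere_zero_iff_norm.1 (hn s),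
          mem_sphere_zero_iff_norm.1 (hn t), mul_one, div_one, ← cos_abs,
          show s * θ - t * θ = θ * (s - t) by ring, abs_mul, abs_of_pos h0]
        exact arccos_cos (by positivity) (by nlinarith [abs_nonneg (s - t)])
      simp only [this]
      ring
    · intro t
      simp only [smul_add, he, smul_smul, smul_sub]
      have h1 : sin ((1 - t) * θ) = sin θ * cos (t * θ) - cos θ * sin (t * θ) := by
        rw [← sin_sub]; ring_nf
      rw [h1]
      match_scalars <;> field_simp
      ring

/-- Existence of spherical triangles with prescribed side lengths. -/
theorem ModelPlane.exists_triangle {l a b : ℝ} (hl0 : 0 < l) (hl : l < π) (ha0 : 0 ≤ a)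
    (hb0 : 0 ≤ b) (h1 : l ≤ a + b) (h2 : a ≤ l + b) (h3 : b ≤ l + a)
    (hp : l + a + b ≤ 2 * π) :
    ∃ u v z : ModelPlane,
      InnerProductGeometry.angle (u : EuclideanSpace ℝ (Fin 3)) v = l ∧
      InnerProductGeometry.angle (v : EuclideanSpace ℝ (Fin 3)) z = a ∧
      InnerProductGeometry.angle (z : EuclideanSpace ℝ (Fin 3)) u = b := by
  have hs : 0 < sin l := sin_pos_of_pos_of_lt_pi hl0 hl
  have hsb : 0 ≤ sin b := sin_nonneg_of_nonneg_of_le_pi hb0 (by linarith)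
  -- `(cos b, y, √(sin² b - y²))` is the third vertex
  set y := (cos a - cos l * cos b) / sin l with hy
  have hys : y * sin l = cos a - cos l * cos b := div_mul_cancel₀ _ hs.ne'
  have hy2 : y ^ 2 ≤ sin b ^ 2 := by
    have hA : cos a ≤ cos (l - b) := by
      rw [← cos_abs (l - b)]
      exact cos_le_cos_of_nonneg_of_le_pi (abs_nonneg _) (by linarith)
        (abs_sub_le_iff.2 ⟨by linarith, by linarith⟩)
    have hB : cos (l + b) ≤ cos a := by
      rcases le_total (l + b) π with h | h
      · exact cos_le_cos_of_nonneg_of_le_pi ha0 h h2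
      · rw [← cos_two_pi_sub]
        exact cos_le_cos_of_nonneg_of_le_pi ha0 (by linarith) (by linarith)
    rw [cos_sub] at hA
    rw [cos_add] at hB
    apply sq_le_sq'
    · by_contra! h
      nlinarith [mul_lt_mul_of_pos_right h hs]
    · by_contra! h
      nlinarith [mul_lt_mul_of_pos_right h hs]
  have hsq : √(sin b ^ 2 - y ^ 2) ^ 2 = sin b ^ 2 - y ^ 2 := sq_sqrt (by linarith)
  have hmem : ∀ p q r : ℝ, p ^ 2 + q ^ 2 + r ^ 2 = 1 →
      (!₂[p, q, r] : EuclideanSpace ℝ (Fin 3)) ∈ Metric.sphere 0 1 := by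
    intro p q r h
    rw [mem_sphere_zero_iff_norm, EuclideanSpace.norm_eq]
    simp [Fin.sum_univ_three, h]
  have hang : ∀ (p q r p' q' r' θ : ℝ), p ^ 2 + q ^ 2 + r ^ 2 = 1 → p' ^ 2 + q' ^ 2 + r' ^ 2 = 1 →
      p * p' + q * q' + r * r' = cos θ → 0 ≤ θ → θ ≤ π →
      InnerProductGeometry.angle (!₂[p, q, r] : EuclideanSpace ℝ (Fin 3)) !₂[p', q', r'] = θ := by
    intro p q r p' q' r' θ h h' hi h0 hθ
    rw [InnerProductGeometry.angle, mem_sphere_zero_iff_norm.1 (hmem _ _ _ h),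
      mem_sphere_zero_iff_norm.1 (hmem _ _ _ h'), mul_one, div_one]
    have : inner ℝ (!₂[p, q, r] : EuclideanSpace ℝ (Fin 3)) !₂[p', q', r'] = cos θ := by
      rw [← hi]
      simp [PiLp.inner_apply, Fin.sum_univ_three]
      ring
    rw [this, arccos_cos h0 hθ]
  have e1 : (1 : ℝ) ^ 2 + 0 ^ 2 + 0 ^ 2 = 1 := by norm_num
  have e2 : cos l ^ 2 + sin l ^ 2 + 0 ^ 2 = 1 := by nlinarith [sin_sq_add_cos_sq l]
  have e3 : cos b ^ 2 + y ^ 2 + √(sin b ^ 2 - y ^ 2) ^ 2 = 1 := by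
    nlinarith [sin_sq_add_cos_sq b]
  refine ⟨⟨_, hmem _ _ _ e1⟩, ⟨_, hmem _ _ _ e2⟩, ⟨_, hmem _ _ _ e3⟩, ?_, ?_, ?_⟩
  · exact hang _ _ _ _ _ _ _ e1 e2 (by ring) hl0.le hl.le
  · exact hang _ _ _ _ _ _ _ e2 e3 (by linarith) ha0 (by linarith)
  · exact hang _ _ _ _ _ _ _ e3 e1 (by ring) hb0 (by linarith)

/-- The `CAT(κ)` comparison between a vertex and the points of the opposite side, in cosine form: the
spherical law of cosines for the comparison triangle has been solved for the distance. -/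
theorem IsCAT.sin_mul_cos_add_le {κ : ℝ} (hκ : 0 < κ) {X : Type*} [MetricSpace X]
    (hX : IsCAT κ X) {x z y : X} (hxz0 : x ≠ z) (hxz : √κ * dist x z < π) (hzy : √κ * dist z y < π)
    (hyx : √κ * dist y x < π) (hp : √κ * (dist x z + dist z y + dist y x) < 2 * π)
    {γ : ℝ → X} (hγ : IsGeodesicFromTo dist γ x z) {t : ℝ} (ht : t ∈ Icc (0 : ℝ) 1) :
    sin ((1 - t) * (√κ * dist x z)) * cos (√κ * dist x y) +
        sin (t * (√κ * dist x z)) * cos (√κ * dist z y) ≤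
      sin (√κ * dist x z) * cos (√κ * dist (γ t) y) := by
  have hk : 0 < √κ := sqrt_pos.2 hκ
  have hD : ∀ l, √κ * l < π → l < modelDiam κ := fun l hl => by
    rw [modelDiam, lt_div_iff₀ hk]; linarith
  obtain ⟨γ₁, hγ₁⟩ := hX.1 z y (hD _ hzy)
  obtain ⟨γ₂, hγ₂⟩ := hX.1 y x (hD _ hyx)
  obtain ⟨u, v, w, huv, hvw, hwu⟩ := ModelPlane.exists_triangle
    (l := √κ * dist x z) (a := √κ * dist z y) (b := √κ * dist y x)
    (mul_pos hk (dist_pos.2 hxz0)) hxz (by positivity) (by positivity)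
    (by rw [← mul_add]; gcongr; linarith [dist_triangle x y z, dist_comm x y, dist_comm z y])
    (by rw [← mul_add]; gcongr; linarith [dist_triangle z x y, dist_comm x y, dist_comm z x])
    (by rw [← mul_add]; gcongr; linarith [dist_triangle y z x, dist_comm x z, dist_comm z y])
    (by linarith)
  obtain ⟨σ, hσ, hσ'⟩ := ModelPlane.exists_geodesic κ u v huv hxz
  obtain ⟨σ₁, hσ₁, -⟩ := ModelPlane.exists_geodesic κ v w hvw hzy
  obtain ⟨σ₂, hσ₂, -⟩ := ModelPlane.exists_geodesic κ w u hwu hyx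
  have key := hX.2 ![x, z, y] ![γ, γ₁, γ₂]
    (by intro i; fin_cases i; exacts [hγ, hγ₁, hγ₂])
    (by
      have : dist x z + dist z y + dist y x < 2 * (π / √κ) := by
        rw [← mul_div_assoc, lt_div_iff₀ hk]; linarith
      simpa [Fin.sum_univ_three, modelDiam] using this)
    ![u, v, w] ![σ, σ₁, σ₂]
    (by intro i; fin_cases i; exacts [hσ, hσ₁, hσ₂])
    (by
      intro i
      fin_cases i
      · exact (by rw [modelDist, huv]; field_simp : modelDist κ u v = dist x z)
      · exact (by rw [modelDist, hvw]; field_simp : modelDist κ v w = dist z y)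
      · exact (by rw [modelDist, hwu]; field_simp : modelDist κ w u = dist y x))
    0 2 t ht 0 (by simp)
  have key' : dist (γ t) y ≤ modelDist κ (σ t) w := by
    have := key
    simp only [Matrix.cons_val_zero, Matrix.cons_val] at this
    rwa [hγ₂.1, hσ₂.1] at this
  rw [modelDist, le_div_iff₀ hk] at key'
  have hcos := cos_le_cos_of_nonneg_of_le_pi (by positivity)
    (InnerProductGeometry.angle_le_pi _ _) key'
  rw [ModelPlane.cos_angle] at hcos
  have hs : 0 < sin (√κ * dist x z) :=
    sin_pos_of_pos_of_lt_pi (mul_pos hk (dist_pos.2 hxz0)) hxz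
  have h := congrArg (fun p => inner ℝ p (w : EuclideanSpace ℝ (Fin 3))) (hσ' t)
  simp only [inner_add_left, inner_smul_left, RCLike.conj_to_real] at h
  rw [← ModelPlane.cos_angle v w, hvw, real_inner_comm (w : EuclideanSpace ℝ (Fin 3)) u,
    ← ModelPlane.cos_angle w u, hwu, dist_comm y x] at h
  rw [mul_comm (√κ) (dist (γ t) y), ← h]
  exact mul_le_mul_of_nonneg_left hcos hs.le

/-- Convex cone property of the distance `k * dist`: in the Euclidean cone over `Y`, where `p` at
height `h` stands for `h • p` and `inner (a • p) (b • q) = a * b * cos (k * dist p q)`, there is a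
point `h • p` which behaves like `α • x + β • z`. Its norm is the one of the sum of two vectors, and
its inner product with every `y` is at least the sum of the inner products. -/
def HasConeCombinations (k : ℝ) (Y : Type*) [MetricSpace Y] : Prop :=
  ∀ x z : Y, ∀ α β : ℝ, 0 < α → 0 < β → ∃ (p : Y) (h : ℝ), 0 < h ∧
    h ^ 2 = α ^ 2 + β ^ 2 + 2 * α * β * cos (k * dist x z) ∧
    ∀ y, α * cos (k * dist x y) + β * cos (k * dist z y) ≤ h * cos (k * dist p y)

/-- A small ball of a `CAT(κ)` space has cone combinations: the direction of `α • x + β • z` is a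
point of the geodesic from `x` to `z`. -/
theorem IsCAT.hasConeCombinations_closedBall {κ : ℝ} (hκ : 0 < κ) {X : Type*} [MetricSpace X]
    (hX : IsCAT κ X) (o : X) {r : ℝ} (hr : √κ * r < π / 4) :
    HasConeCombinations (√κ) (Metric.closedBall o r) := by
  have hk : 0 < √κ := sqrt_pos.2 hκ
  -- a cone combination in `X` lies in the ball, since its direction is not farther from `o`
  suffices H : ∀ x ∈ Metric.closedBall o r, ∀ z ∈ Metric.closedBall o r, ∀ α β : ℝ, 0 < α → 0 < β →
      ∃ (p : X) (h : ℝ), 0 < h ∧ √κ * dist p o < π ∧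
      h ^ 2 = α ^ 2 + β ^ 2 + 2 * α * β * cos (√κ * dist x z) ∧
      ∀ y ∈ Metric.closedBall o r,
        α * cos (√κ * dist x y) + β * cos (√κ * dist z y) ≤ h * cos (√κ * dist p y) by
    rintro ⟨x, hx⟩ ⟨z, hz⟩ α β hα hβ
    obtain ⟨p, h, h0, hpπ, h2, hp⟩ := H x hx z hz α β hα hβ
    have hr0 : 0 ≤ r := dist_nonneg.trans hx
    have hpo := hp o (Metric.mem_closedBall_self hr0)
    have hc : 0 < cos (√κ * r) :=
      cos_pos_of_mem_Ioo ⟨by linarith [pi_pos, mul_nonneg hk.le hr0], by linarith [pi_pos]⟩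
    have hle : ∀ q ∈ Metric.closedBall o r, cos (√κ * r) ≤ cos (√κ * dist q o) := fun q hq =>
      cos_le_cos_of_nonneg_of_le_pi (by positivity) (by linarith [pi_pos]) (by gcongr; exact hq)
    have hhab : h ≤ α + β := by
      refine le_of_sq_le_sq ?_ (by positivity)
      nlinarith [cos_le_one (√κ * dist x z), mul_pos hα hβ]
    have hpr : p ∈ Metric.closedBall o r := by
      rw [Metric.mem_closedBall]
      by_contra! hlt
      have h3 : cos (√κ * dist p o) < cos (√κ * r) :=
        cos_lt_cos_of_nonneg_of_le_pi (by positivity) hpπ.le (by gcongr)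
      nlinarith [mul_le_mul_of_nonneg_left (hle x hx) hα.le,
        mul_le_mul_of_nonneg_left (hle z hz) hβ.le]
    exact ⟨⟨p, hpr⟩, h, h0, h2, fun y => hp y y.2⟩
  intro x hx z hz α β hα hβ
  have hd : ∀ p ∈ Metric.closedBall o r, ∀ q ∈ Metric.closedBall o r, √κ * dist p q < π / 2 := by
    intro p hp q hq
    have := dist_triangle_right p q o
    have h2 : √κ * dist p q ≤ √κ * (2 * r) := by
      gcongr; linarith [Metric.mem_closedBall.1 hp, Metric.mem_closedBall.1 hq]
    linarith
  rcases eq_or_ne x z with rfl | hne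
  · refine ⟨x, α + β, by positivity, ?_, by simp; ring, fun y _ => by rw [add_mul]⟩
    have h2 : √κ * dist x o ≤ √κ * r := by gcongr; exact hx
    linarith [pi_pos]
  set l := √κ * dist x z with hl
  have hl0 : 0 < l := mul_pos hk (dist_pos.2 hne)
  have hl1 : l < π / 2 := hd x hx z hz
  have hsl : 0 < sin l := sin_pos_of_pos_of_lt_pi hl0 (by linarith [pi_pos])
  obtain ⟨γ, hγ⟩ := hX.1 x z (by rw [modelDiam, lt_div_iff₀ hk]; linarith [pi_pos])
  -- the direction of `α x + β z` divides the geodesic at the parameter `t` where the two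
  -- spherical weights have ratio `α : β`
  obtain ⟨t, ht, hteq⟩ : ∃ t ∈ Icc (0 : ℝ) 1,
      α * sin (t * l) - β * sin ((1 - t) * l) = 0 := by
    have hc : ContinuousOn (fun t : ℝ => α * sin (t * l) - β * sin ((1 - t) * l)) (Icc 0 1) := by
      fun_prop
    have := intermediate_value_Icc zero_le_one hc
    simp only [zero_mul, sin_zero, mul_zero, sub_zero, one_mul, zero_sub, sub_self] at this
    exact this ⟨by nlinarith [mul_pos hβ hsl], by positivity⟩
  have hA : 0 ≤ sin ((1 - t) * l) := sin_nonneg_of_nonneg_of_le_pi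
    (mul_nonneg (by linarith [ht.2]) hl0.le) (by nlinarith [ht.1, pi_pos])
  have hsum : sin ((1 - t) * l) ^ 2 + sin (t * l) ^ 2 +
      2 * sin ((1 - t) * l) * sin (t * l) * cos l = sin l ^ 2 := by
    have e : l = (1 - t) * l + t * l := by ring
    have ec : cos l = cos ((1 - t) * l) * cos (t * l) - sin ((1 - t) * l) * sin (t * l) := by
      rw [← cos_add, ← e]
    have es : sin l = sin ((1 - t) * l) * cos (t * l) + cos ((1 - t) * l) * sin (t * l) := by
      rw [← sin_add, ← e]
    have q1 := sin_sq_add_cos_sq ((1 - t) * l)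
    have q2 := sin_sq_add_cos_sq (t * l)
    rw [ec, es]
    linear_combination (-sin ((1 - t) * l) ^ 2) * q2 - sin (t * l) ^ 2 * q1
  have hA0 : 0 < sin ((1 - t) * l) := by
    refine hA.lt_of_ne' fun h0 => ?_
    have hB : sin (t * l) = 0 := by
      rw [h0] at hteq; simpa [hα.ne'] using hteq
    rw [h0, hB] at hsum
    nlinarith [pow_pos hsl 2]
  set A := sin ((1 - t) * l)
  set B := sin (t * l)
  have hB : β = α * B / A := by field_simp; linarith
  refine ⟨γ t, α * sin l / A, by positivity, ?_, ?_, ?_⟩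
  · obtain ⟨h0, h1, c, hc0, hc⟩ := hγ
    have hc1 : c = dist x z := by
      have := hc 0 (by simp) 1 (by simp)
      rw [h0, h1] at this; simpa using this.symm
    have hxt : dist (γ t) x ≤ dist x z := by
      have := hc t ht 0 (by simp)
      rw [h0, hc1, sub_zero, abs_of_nonneg ht.1] at this
      rw [this]; exact mul_le_of_le_one_right dist_nonneg ht.2
    have h5 : √κ * dist (γ t) o ≤ √κ * (dist x z + r) := by
      gcongr
      linarith [dist_triangle (γ t) x o, Metric.mem_closedBall.1 hx]
    linarith
  · rw [hB, div_pow, mul_pow, ← hsum]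
    field_simp
  · intro y hy
    have hxy := hd x hx y hy
    have hzy := hd z hz y hy
    have := hX.sin_mul_cos_add_le hκ hne (by linarith) (by linarith : √κ * dist z y < π)
      (by rw [dist_comm]; linarith) (by rw [dist_comm y x]; linarith) hγ ht
    rw [hB]
    calc α * cos (√κ * dist x y) + α * B / A * cos (√κ * dist z y)
        = α / A * (A * cos (√κ * dist x y) + B * cos (√κ * dist z y)) := by field_simp
      _ ≤ α / A * (sin l * cos (√κ * dist (γ t) y)) := by gcongr
      _ = _ := by ring

/-! ### Quadrilaterals and midpoints -/

/-- Reshetnyak's quadrilateral inequality for the points `x`, `y`, `t • b₁`, `s • b₂` of the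
Euclidean cone, that is `inner (x - y) (t • b₁ - s • b₂) ≤ ‖x - y‖ * ‖t • b₁ - s • b₂‖`, with the
product on the right replaced by its bound through Young's inequality. The proof compares `y` and
`t • b₁` through a point of the diagonal from `x` to `s • b₂`. -/
theorem HasConeCombinations.quadrilateral {k : ℝ} {Y : Type*} [MetricSpace Y]
    (hY : HasConeCombinations k Y) (hk : 0 ≤ k) (hd : ∀ p q : Y, k * dist p q ≤ π / 2)
    (x y b₁ b₂ : Y) {s t η : ℝ} (hs : 0 < s) (ht : 0 < t) (hη : 0 < η) :
    2 * (t * cos (k * dist b₁ x) + s * cos (k * dist b₂ y) - s * cos (k * dist b₂ x) -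
        t * cos (k * dist b₁ y)) ≤
      η * (2 - 2 * cos (k * dist x y)) +
        ((t - s) ^ 2 + s * t * (2 - 2 * cos (k * dist b₁ b₂))) / η := by
  obtain ⟨p, h, h0, h2, hp⟩ := hY x b₂ η s hη hs
  have hy := hp y
  have hb := hp b₁
  -- the triangle inequality at `p`: the diagonal from `y` to `b₁` spans an angle of at most the sum
  have htri : cos (k * dist p y + k * dist p b₁) ≤ cos (k * dist b₁ y) := by
    refine cos_le_cos_of_nonneg_of_le_pi (by positivity) (by linarith [hd p y, hd p b₁]) ?_
    rw [← mul_add, dist_comm p b₁, add_comm]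
    exact mul_le_mul_of_nonneg_left (dist_triangle b₁ p y) hk
  rw [cos_add] at htri
  have q1 := sin_sq_add_cos_sq (k * dist p y)
  have q2 := sin_sq_add_cos_sq (k * dist p b₁)
  rw [dist_comm x b₁] at hb
  rw [dist_comm x b₂] at h2
  rw [dist_comm b₂ b₁] at hb
  set A := cos (k * dist p y)
  set A' := sin (k * dist p y)
  set B := cos (k * dist p b₁)
  set B' := sin (k * dist p b₁)
  have hsq : 0 ≤ h ^ 2 - 2 * η * (h * A) - 2 * t * (h * B) + η ^ 2 + t ^ 2 +
      2 * η * t * (A * B - A' * B') := by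
    have := add_nonneg (sq_nonneg (h - η * A - t * B)) (sq_nonneg (η * A' - t * B'))
    have e : (h - η * A - t * B) ^ 2 + (η * A' - t * B') ^ 2 =
        h ^ 2 - 2 * η * (h * A) - 2 * t * (h * B) + η ^ 2 + t ^ 2 +
          2 * η * t * (A * B - A' * B') := by
      linear_combination η ^ 2 * q1 + t ^ 2 * q2
    linarith
  have e1 := mul_le_mul_of_nonneg_left hy (by positivity : 0 ≤ 2 * η)
  have e2 := mul_le_mul_of_nonneg_left hb (by positivity : 0 ≤ 2 * t)
  have e3 := mul_le_mul_of_nonneg_left htri (by positivity : 0 ≤ 2 * η * t)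
  refine le_of_mul_le_mul_left ?_ hη
  rw [mul_add, mul_div_cancel₀ _ hη.ne']
  linarith

/-- Uniform convexity of the squared distance functions, with the same midpoint for all `y`. -/
theorem HasConeCombinations.exists_midpoint {k a : ℝ} {Y : Type*} [MetricSpace Y]
    (hY : HasConeCombinations k Y) (hk : 0 < k) (ha : a < π / 2)
    (hd : ∀ p q : Y, k * dist p q ≤ a) (x z : Y) :
    ∃ p : Y, ∀ y, dist p y ^ 2 ≤
      (dist x y ^ 2 + dist z y ^ 2) / 2 - 2 * cos a / π ^ 2 * dist x z ^ 2 := by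
  obtain ⟨p, h, h0, h2, hp⟩ := hY x z 1 1 one_pos one_pos
  refine ⟨p, fun y => ?_⟩
  have hmem : ∀ p q : Y, k * dist p q ∈ Icc 0 (π / 2) :=
    fun p q => ⟨by positivity, (hd p q).trans ha.le⟩
  have hpy := hp y
  have h_le : h ≤ 2 := by nlinarith [cos_le_one (k * dist x z)]
  have hw := one_le_sincInv (hmem p y).1 (hmem p y).2
  have t1 := sq_le_sq_add_sincInv_mul (hmem p y) (hmem x y)
  have t2 := sq_le_sq_add_sincInv_mul (hmem p y) (hmem z y)
  have hch := sq_le_chord_sq (hmem x z).1 (hmem x z).2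
  have hc : cos a ≤ cos (k * dist p y) :=
    cos_le_cos_of_nonneg_of_le_pi (by positivity) (by linarith [pi_pos]) (hd p y)
  have ha0 : 0 ≤ a := (mul_nonneg hk.le dist_nonneg).trans (hd x z)
  have hc0 : 0 < cos a := cos_pos_of_mem_Ioo ⟨by linarith [pi_pos], ha⟩
  set w := sincInv (k * dist p y)
  set m := cos (k * dist p y)
  have e1 : w * ((2 - h) * m) ≤ w * (2 * m - cos (k * dist x y) - cos (k * dist z y)) := by
    gcongr; linarith
  have e2 : (2 - h) * cos a ≤ w * ((2 - h) * m) := by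
    have : (2 - h) * cos a ≤ (2 - h) * m := by gcongr
    have : 0 ≤ (2 - h) * m := mul_nonneg (by linarith) (by linarith)
    nlinarith
  -- `2 - h` is at least a quarter of the squared chord `4 - h²`
  have e3 : k ^ 2 * dist x z ^ 2 ≤ π ^ 2 / 2 * (2 - h) := by
    rw [← mul_pow]
    have : 2 - 2 * cos (k * dist x z) ≤ 4 * (2 - h) := by nlinarith
    nlinarith [mul_le_mul_of_nonneg_left this (by positivity : 0 ≤ π ^ 2 / 8)]
  have e4 : k ^ 2 * (2 * cos a / π ^ 2 * dist x z ^ 2) ≤ (2 - h) * cos a := by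
    calc k ^ 2 * (2 * cos a / π ^ 2 * dist x z ^ 2)
        = 2 * cos a / π ^ 2 * (k ^ 2 * dist x z ^ 2) := by ring
      _ ≤ 2 * cos a / π ^ 2 * (π ^ 2 / 2 * (2 - h)) := by gcongr
      _ = _ := by field_simp
  simp only [mul_pow] at t1 t2
  refine le_of_mul_le_mul_left ?_ (pow_pos hk 2)
  linarith

/-- A nonnegative continuous function on a complete space which is uniformly midpoint convex has a
unique minimizer: minimizing sequences are Cauchy. -/
theorem existsUnique_isMin_of_midpoint {Y : Type*} [MetricSpace Y] [CompleteSpace Y] [Nonempty Y]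
    {F : Y → ℝ} (hF0 : ∀ z, 0 ≤ F z) (hFc : Continuous F) {c : ℝ} (hc : 0 < c)
    (hF : ∀ x z, ∃ p, F p ≤ (F x + F z) / 2 - c * dist x z ^ 2) :
    ∃! b, ∀ z, F b ≤ F z := by
  have hbdd : BddBelow (range F) := ⟨0, by rintro _ ⟨z, rfl⟩; exact hF0 z⟩
  set I := ⨅ z, F z
  have hI : ∀ z, I ≤ F z := fun z => ciInf_le hbdd z
  have hdist : ∀ x z : Y, ∀ δ, F x ≤ I + δ → F z ≤ I + δ → c * dist x z ^ 2 ≤ δ := by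
    intro x z δ hx hz
    obtain ⟨p, hp⟩ := hF x z
    linarith [hI p]
  have hlim : Tendsto (fun n : ℕ => √(1 / ((n : ℝ) + 1) / c)) atTop (𝓝 0) := by
    have h := (tendsto_one_div_add_atTop_nhds_zero_nat (𝕜 := ℝ)).div_const c
    rw [zero_div] at h
    have := (continuous_sqrt.tendsto 0).comp h
    rwa [sqrt_zero] at this
  choose x hx using fun n : ℕ =>
    exists_lt_of_ciInf_lt (show I < I + 1 / ((n : ℝ) + 1) from lt_add_of_pos_right _ Nat.one_div_pos_of_nat)
  have hxb : ∀ n m : ℕ, n ≤ m → F (x m) ≤ I + 1 / ((n : ℝ) + 1) := fun n m hnm =>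
    (hx m).le.trans (by gcongr)
  have hcau : CauchySeq x := by
    refine cauchySeq_of_le_tendsto_0 _ (fun n m N hn hm => ?_) hlim
    refine le_sqrt_of_sq_le ?_
    rw [le_div_iff₀ hc, mul_comm]
    exact hdist _ _ _ (hxb N n hn) (hxb N m hm)
  obtain ⟨b, hb⟩ := cauchySeq_tendsto_of_complete hcau
  have hFb : F b ≤ I := by
    have h1 : Tendsto (fun n => F (x n)) atTop (𝓝 (F b)) := (hFc.tendsto b).comp hb
    have h2 : Tendsto (fun n : ℕ => I + 1 / ((n : ℝ) + 1)) atTop (𝓝 (I + 0)) :=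
      tendsto_const_nhds.add tendsto_one_div_add_atTop_nhds_zero_nat
    rw [add_zero] at h2
    exact le_of_tendsto_of_tendsto' h1 h2 fun n => (hx n).le
  refine ⟨b, fun z => hFb.trans (hI z), fun b' hb' => ?_⟩
  have := hdist b' b 0 (by linarith [hb' b]) (by linarith)
  have h0 : dist b' b ^ 2 ≤ 0 := by nlinarith
  exact dist_eq_zero.1 (pow_eq_zero_iff two_ne_zero |>.1 (le_antisymm h0 (sq_nonneg _)))

/-! ### Existence of barycenters and first variation -/

section Measure

variable {Y : Type*} [MetricSpace Y] [MeasurableSpace Y] [BorelSpace Y]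

theorem measurable_sincInv : Measurable sincInv := continuous_sinc.measurable.inv

theorem integrable_dist_sq {C : ℝ} (hC : ∀ p q : Y, dist p q ≤ C) (μ : Measure Y)
    [IsProbabilityMeasure μ] (z : Y) : Integrable (fun x => dist z x ^ 2) μ := by
  refine Integrable.of_bound (C := C ^ 2)
    (by fun_prop : Continuous fun x => dist z x ^ 2).measurable.aestronglyMeasurable
    (Eventually.of_forall fun x => ?_)
  rw [norm_of_nonneg (by positivity)]
  exact pow_le_pow_left₀ dist_nonneg (hC z x) 2

/-- On a bounded space the lower integrals in the definition of a barycenter are Bochner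
integrals. -/
theorem isBarycenter_iff {C : ℝ} (hC : ∀ p q : Y, dist p q ≤ C) (μ : Measure Y)
    [IsProbabilityMeasure μ] (b : Y) :
    IsBarycenter μ b ↔ ∀ z, ∫ x, dist b x ^ 2 ∂μ ≤ ∫ x, dist z x ^ 2 ∂μ := by
  have h : ∀ z, ∫⁻ x, edist z x ^ 2 ∂μ = ENNReal.ofReal (∫ x, dist z x ^ 2 ∂μ) := by
    intro z
    rw [ofReal_integral_eq_lintegral_ofReal (integrable_dist_sq hC μ z)
      (Eventually.of_forall fun x => by positivity)]
    simp only [edist_dist, ENNReal.ofReal_pow dist_nonneg]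
  refine forall_congr' fun z => ?_
  rw [h, h, ENNReal.ofReal_le_ofReal_iff (integral_nonneg fun x => by positivity)]

theorem HasConeCombinations.existsUnique_isBarycenter [CompleteSpace Y] {k a : ℝ}
    (hY : HasConeCombinations k Y) (hk : 0 < k) (ha : a < π / 2)
    (hd : ∀ p q : Y, k * dist p q ≤ a) (μ : Measure Y) [IsProbabilityMeasure μ] :
    ∃! b, IsBarycenter μ b := by
  have hC : ∀ p q : Y, dist p q ≤ a / k := fun p q => by
    rw [le_div_iff₀ hk, mul_comm]; exact hd p q
  have : Nonempty Y := nonempty_of_isProbabilityMeasure μ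
  have ha0 : 0 ≤ a := by
    obtain ⟨y⟩ := this
    simpa using hd y y
  have hc0 : 0 < cos a := cos_pos_of_mem_Ioo ⟨by linarith [pi_pos], ha⟩
  simp only [isBarycenter_iff hC]
  refine existsUnique_isMin_of_midpoint (c := 2 * cos a / π ^ 2)
    (fun z => integral_nonneg fun x => by positivity) ?_ (by positivity) fun x z => ?_
  · refine continuous_of_dominated (bound := fun _ => (a / k) ^ 2)
      (fun z => (integrable_dist_sq hC μ z).aestronglyMeasurable)
      (fun z => Eventually.of_forall fun x => ?_) (integrable_const _)
      (Eventually.of_forall fun x => by fun_prop)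
    rw [norm_of_nonneg (by positivity)]
    exact pow_le_pow_left₀ dist_nonneg (hC z x) 2
  · obtain ⟨p, hp⟩ := hY.exists_midpoint hk ha hd x z
    refine ⟨p, ?_⟩
    have i1 := integrable_dist_sq hC μ
    have i2 : Integrable (fun y => (dist x y ^ 2 + dist z y ^ 2) / 2) μ :=
      ((i1 x).add (i1 z)).div_const 2
    have := integral_mono (i1 p) (i2.sub (integrable_const (2 * cos a / π ^ 2 * dist x z ^ 2))) hp
    simp only [Pi.sub_apply] at this
    rwa [integral_sub i2 (integrable_const _), integral_div, integral_add (i1 x) (i1 z),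
      integral_const, probReal_univ, one_smul] at this

theorem sincInv_le_pi_div_two {ρ : ℝ} (h0 : 0 ≤ ρ) (h1 : ρ ≤ π / 2) : sincInv ρ ≤ π / 2 := by
  have := monotoneOn_sincInv ⟨h0, h1⟩ (right_mem_Icc.2 (by positivity)) h1
  rwa [sincInv_of_ne_zero (by positivity : π / 2 ≠ 0), sin_pi_div_two, div_one] at this

/-- First variation of the minimized function at a barycenter `b` in the direction of `z`. In terms
of the cone, the barycenter is perturbed to `b + β • z` with `β → 0`. -/
theorem HasConeCombinations.firstVariation {k : ℝ}
    (hY : HasConeCombinations k Y) (hk : 0 < k)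
    (hd : ∀ p q : Y, k * dist p q ≤ π / 2) (μ : Measure Y) [IsProbabilityMeasure μ]
    {b : Y} (hb : IsBarycenter μ b) (z : Y) :
    ∫ x, sincInv (k * dist b x) * cos (k * dist z x) ∂μ ≤
      cos (k * dist b z) * ∫ x, sincInv (k * dist b x) * cos (k * dist b x) ∂μ := by
  have hC : ∀ p q : Y, dist p q ≤ π / 2 / k := fun p q => by
    rw [le_div_iff₀ hk, mul_comm]; exact hd p q
  rw [isBarycenter_iff hC] at hb
  have hmem : ∀ p q : Y, k * dist p q ∈ Icc 0 (π / 2) := fun p q => ⟨by positivity, hd p q⟩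
  have hcos : ∀ p q : Y, 0 ≤ cos (k * dist p q) := fun p q =>
    cos_nonneg_of_mem_Icc ⟨by linarith [pi_pos, (hmem p q).1], (hmem p q).2⟩
  have hmd : ∀ p : Y, Measurable fun x => k * dist p x := fun p =>
    (by fun_prop : Continuous fun x => k * dist p x).measurable
  set D := k * dist b z with hD
  set β : ℕ → ℝ := fun n => 1 / ((n : ℝ) + 1) with hβ
  have hβ0 : ∀ n, 0 < β n := fun n => Nat.one_div_pos_of_nat
  have hβ1 : ∀ n, β n ≤ 1 := fun n => by
    simp only [hβ]; rw [div_le_one (by positivity)]; linarith [(Nat.cast_nonneg n : (0 : ℝ) ≤ n)]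
  have hβl : Tendsto β atTop (𝓝 0) := tendsto_one_div_add_atTop_nhds_zero_nat
  choose p h h0 h2 hp using fun n => hY b z 1 (β n) one_pos (hβ0 n)
  have hD1 : cos D ≤ 1 := cos_le_one D
  have hD0 : 0 ≤ cos D := hcos b z
  have h1 : ∀ n, 1 ≤ h n := fun n => by
    have := h2 n
    nlinarith [h0 n, hβ0 n, mul_nonneg (hβ0 n).le hD0]
  have hle : ∀ n, h n ≤ 1 + β n := fun n => by
    refine le_of_sq_le_sq ?_ (by linarith [hβ0 n])
    rw [h2 n]; nlinarith [mul_le_mul_of_nonneg_left hD1 (hβ0 n).le]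
  have hhl : Tendsto h atTop (𝓝 1) := by
    refine tendsto_of_tendsto_of_tendsto_of_le_of_le tendsto_const_nhds ?_ h1 hle
    simpa using (tendsto_const_nhds (x := (1 : ℝ))).add hβl
  have hpb : Tendsto p atTop (𝓝 b) := by
    rw [tendsto_iff_dist_tendsto_zero]
    have hsq : ∀ n, dist (p n) b ≤ √(π ^ 2 / 4 * (h n - 1)) / k := fun n => by
      rw [le_div_iff₀ hk, mul_comm]
      refine le_sqrt_of_sq_le ?_
      have e := sq_le_chord_sq (hmem (p n) b).1 (hmem (p n) b).2
      have e2 := hp n b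
      simp only [dist_self, mul_zero, cos_zero, mul_one] at e2
      have e3 : 1 - cos (k * dist (p n) b) ≤ h n - 1 := by
        nlinarith [h1 n, mul_nonneg (hβ0 n).le (hcos z b), cos_le_one (k * dist (p n) b)]
      nlinarith [mul_le_mul_of_nonneg_left e3 (by positivity : 0 ≤ π ^ 2 / 4)]
    refine squeeze_zero (fun _ => dist_nonneg) hsq ?_
    have : Tendsto (fun n => √(π ^ 2 / 4 * (h n - 1)) / k) atTop
        (𝓝 (√(π ^ 2 / 4 * (1 - 1)) / k)) :=
      ((continuous_sqrt.tendsto _).comp ((hhl.sub_const 1).const_mul _)).div_const k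
    simpa using this
  -- the difference quotient `(h - 1) / β`, written without cancellation
  set Q : ℕ → ℝ := fun n => (β n + 2 * cos D) / (h n + 1) with hQ
  have hQβ : ∀ n, h n - 1 = β n * Q n := fun n => by
    have := h1 n
    have := h2 n
    simp only [hQ]
    rw [← mul_div_assoc, eq_div_iff (by linarith)]
    linear_combination this
  have hQl : Tendsto Q atTop (𝓝 (cos D)) := by
    have := (hβl.add_const (2 * cos D)).div (hhl.add_const 1) (by norm_num)
    rwa [show (0 + 2 * cos D) / (1 + 1) = cos D by ring] at this
  have hQ0 : ∀ n, 0 ≤ Q n := fun n => by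
    have := h1 n; have := hβ0 n
    exact div_nonneg (by linarith) (by linarith)
  have hQ1 : ∀ n, Q n ≤ 2 := fun n => by
    have := h1 n; have := hβ1 n
    simp only [hQ]
    rw [div_le_iff₀ (by linarith)]; linarith
  set G : ℕ → Y → ℝ := fun n x =>
    sincInv (k * dist (p n) x) * (Q n * cos (k * dist b x) - cos (k * dist z x)) with hG
  have hGm : ∀ n, AEStronglyMeasurable (G n) μ := fun n =>
    ((measurable_sincInv.comp (hmd (p n))).mul (((measurable_cos.comp (hmd b)).const_mul (Q n)).sub
      (measurable_cos.comp (hmd z)))).aestronglyMeasurable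
  have hGb : ∀ n x, ‖G n x‖ ≤ π / 2 * 2 := fun n x => by
    simp only [hG, norm_mul]
    have w1 := one_le_sincInv (hmem (p n) x).1 (hmem (p n) x).2
    have w2 := sincInv_le_pi_div_two (hmem (p n) x).1 (hmem (p n) x).2
    have hc1 := cos_le_one (k * dist b x)
    have hc2 := cos_le_one (k * dist z x)
    have q1 := mul_le_mul (hQ1 n) hc1 (hcos b x) (by norm_num)
    have q2 := mul_nonneg (hQ0 n) (hcos b x)
    refine mul_le_mul ?_ ?_ (norm_nonneg _) (by positivity)
    · rw [norm_of_nonneg (by linarith)]; exact w2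
    · rw [norm_eq_abs, abs_le]
      exact ⟨by linarith, by linarith [hcos z x]⟩
  have hG0 : ∀ n, 0 ≤ ∫ x, G n x ∂μ := fun n => by
    -- `hb` bounds the integral of the left side from below by `0`
    have hpt : ∀ x, h n * k ^ 2 * (dist (p n) x ^ 2 - dist b x ^ 2) ≤ 2 * β n * G n x := by
      intro x
      have t := sq_le_sq_add_sincInv_mul (hmem (p n) x) (hmem b x)
      have w1 := one_le_sincInv (hmem (p n) x).1 (hmem (p n) x).2
      have c := hp n x
      simp only [mul_pow, hG] at t ⊢
      set w := sincInv (k * dist (p n) x)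
      have t' := mul_le_mul_of_nonneg_left t (h0 n).le
      have c' := mul_le_mul_of_nonneg_left c (by linarith : 0 ≤ 2 * w)
      have e := hQβ n
      have e' : h n = 1 + β n * Q n := by linarith
      have : 2 * β n * (w * (Q n * cos (k * dist b x) - cos (k * dist z x))) =
          2 * w * (h n - 1) * cos (k * dist b x) - 2 * w * β n * cos (k * dist z x) := by
        rw [e]; ring
      rw [this]
      linarith
    have i := integrable_dist_sq hC μ
    have hGi : Integrable (G n) μ :=
      Integrable.of_bound (hGm n) _ (Eventually.of_forall (hGb n))
    have := integral_mono (((i (p n)).sub (i b)).const_mul (h n * k ^ 2))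
      (hGi.const_mul (2 * β n)) hpt
    simp only [Pi.sub_apply] at this
    rw [integral_const_mul, integral_const_mul, integral_sub (i (p n)) (i b)] at this
    have hpos : 0 ≤ h n * k ^ 2 * (∫ x, dist (p n) x ^ 2 ∂μ - ∫ x, dist b x ^ 2 ∂μ) :=
      mul_nonneg (mul_nonneg (h0 n).le (sq_nonneg k)) (sub_nonneg.2 (hb (p n)))
    have := hpos.trans this
    exact (mul_nonneg_iff_of_pos_left (by linarith [hβ0 n])).1 this
  have hlim := tendsto_integral_of_dominated_convergence (μ := μ) (F := G)
    (f := fun x => sincInv (k * dist b x) * (cos D * cos (k * dist b x) - cos (k * dist z x)))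
    (fun _ => π / 2 * 2) hGm (integrable_const _) (fun n => Eventually.of_forall (hGb n))
    (Eventually.of_forall fun x => by
      refine Tendsto.mul ?_ ((hQl.mul_const _).sub_const _)
      have hdx : Tendsto (fun n => k * dist (p n) x) atTop (𝓝 (k * dist b x)) :=
        (hpb.dist tendsto_const_nhds).const_mul k
      exact ((continuous_sinc.tendsto _).comp hdx).inv₀
        (sinc_pos_of_mem (hmem b x).1 (hmem b x).2).ne')
  have hfin := ge_of_tendsto' hlim hG0
  have hint : ∀ q : Y, Integrable (fun x => sincInv (k * dist b x) * cos (k * dist q x)) μ := by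
    intro q
    refine Integrable.of_bound (C := π / 2)
      ((measurable_sincInv.comp (hmd b)).mul (measurable_cos.comp (hmd q))).aestronglyMeasurable
      (Eventually.of_forall fun x => ?_)
    have w1 := one_le_sincInv (hmem b x).1 (hmem b x).2
    have w2 := sincInv_le_pi_div_two (hmem b x).1 (hmem b x).2
    rw [norm_mul, norm_of_nonneg (by linarith), norm_of_nonneg (hcos q x)]
    nlinarith [cos_le_one (k * dist q x)]
  have heq : ∫ x, sincInv (k * dist b x) * (cos D * cos (k * dist b x) - cos (k * dist z x)) ∂μ =
      cos D * ∫ x, sincInv (k * dist b x) * cos (k * dist b x) ∂μ -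
        ∫ x, sincInv (k * dist b x) * cos (k * dist z x) ∂μ := by
    rw [← integral_const_mul, ← integral_sub ((hint b).const_mul _) (hint z)]
    congr 1; ext x; ring
  linarith

/-! ### The Lipschitz estimate -/

/-- The arithmetic behind the constant: `S` and `P` are compared with the mean `m`, and
`(1 + M)² / (4 M)` and `C² = (1 + c) / 2` combine to `1 / √c`. -/
theorem chord_sq_le_of_estimates {S P V m M c C q : ℝ} (hc : 0 < c) (hC0 : 0 ≤ C)
    (hC : C ^ 2 = (1 + c) / 2) (hM : 1 ≤ M) (hMc : M ^ 2 * c ≤ 1) (hV : 0 ≤ V) (hq : 0 ≤ q)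
    (hm : 0 < m) (hS : C * m ≤ S) (hP : P ≤ (1 + M) * m - M) (h : q * S ^ 2 ≤ V * P) :
    q ≤ V / √c := by
  have hK := kantorovich_le hM hc hMc
  have hP2 : P ≤ (1 + M) ^ 2 / (4 * M) * m ^ 2 := by
    rw [div_mul_eq_mul_div, le_div_iff₀ (by positivity)]
    nlinarith [sq_nonneg ((1 + M) * m - 2 * M), mul_le_mul_of_nonneg_right hP (by linarith : 0 ≤ 4 * M)]
  have h1 : q * ((1 + c) / 2 * m ^ 2) ≤ V * ((1 + c) / (2 * √c) * m ^ 2) :=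
    calc q * ((1 + c) / 2 * m ^ 2) = q * (C * m) ^ 2 := by rw [mul_pow, hC]
      _ ≤ q * S ^ 2 := by gcongr
      _ ≤ V * P := h
      _ ≤ V * ((1 + c) / (2 * √c) * m ^ 2) := by gcongr; exact hP2.trans (by gcongr)
  have hu : 0 < √c := sqrt_pos.2 hc
  have h2 : V * ((1 + c) / (2 * √c) * m ^ 2) = V / √c * ((1 + c) / 2 * m ^ 2) := by field_simp
  rw [h2] at h1
  exact le_of_mul_le_mul_right h1 (by positivity)

/-- The Lipschitz estimate for chords. A coupling is given by two maps from a probability space, so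
that no σ-algebra on `Y × Y` has to be fixed. -/
theorem HasConeCombinations.chord_sq_le {k a : ℝ} (hY : HasConeCombinations k Y) (hk : 0 < k)
    (ha : a < π / 2) (o : Y) (ho : ∀ x : Y, k * dist o x ≤ a / 2)
    {Ω : Type*} [MeasurableSpace Ω] (ν : Measure Ω) [IsProbabilityMeasure ν] {f₁ f₂ : Ω → Y}
    (hf₁ : Measurable f₁) (hf₂ : Measurable f₂) (hf : Measurable fun ω => dist (f₁ ω) (f₂ ω))
    {b₁ b₂ : Y} (hb₁ : IsBarycenter (ν.map f₁) b₁) (hb₂ : IsBarycenter (ν.map f₂) b₂) :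
    2 - 2 * cos (k * dist b₁ b₂) ≤
      (∫ ω, (2 - 2 * cos (k * dist (f₁ ω) (f₂ ω))) ∂ν) / √(cos a) := by
  have ha0 : 0 ≤ a := by linarith [(mul_nonneg hk.le dist_nonneg).trans (ho o)]
  have hd : ∀ p q : Y, k * dist p q ≤ a := fun p q => by
    have := mul_le_mul_of_nonneg_left (dist_triangle_left p q o) hk.le
    linarith [ho p, ho q]
  have hd' : ∀ p q : Y, k * dist p q ≤ π / 2 := fun p q => (hd p q).trans ha.le
  have hmem : ∀ p q : Y, k * dist p q ∈ Icc 0 (π / 2) := fun p q => ⟨by positivity, hd' p q⟩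
  have hcos : ∀ p q : Y, 0 ≤ cos (k * dist p q) := fun p q =>
    cos_nonneg_of_mem_Icc ⟨by linarith [pi_pos, (hmem p q).1], (hmem p q).2⟩
  have hc : 0 < cos a := cos_pos_of_mem_Ioo ⟨by linarith [pi_pos], ha⟩
  have hR : 0 < cos (a / 2) := cos_pos_of_mem_Ioo ⟨by linarith [pi_pos], by linarith⟩
  have hmd : ∀ p : Y, Measurable fun x => k * dist p x := fun p =>
    (by fun_prop : Continuous fun x => k * dist p x).measurable
  have hw1 : ∀ p q : Y, 1 ≤ sincInv (k * dist p q) := fun p q =>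
    one_le_sincInv (hmem p q).1 (hmem p q).2
  have hwM : ∀ p q : Y, sincInv (k * dist p q) ≤ sincInv a := fun p q =>
    monotoneOn_sincInv (hmem p q) ⟨ha0, ha.le⟩ (hd p q)
  have hM1 : 1 ≤ sincInv a := one_le_sincInv ha0 ha.le
  have hMc := sincInv_sq_mul_cos_le_one ha0 ha
  set M := sincInv a
  -- the first variation inequalities, transported to `Ω`
  have hgm : ∀ b p : Y, Measurable fun x => sincInv (k * dist b x) * cos (k * dist p x) :=
    fun b p => (measurable_sincInv.comp (hmd b)).mul (measurable_cos.comp (hmd p))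
  have fv : ∀ (f : Ω → Y) (b : Y), Measurable f → IsBarycenter (ν.map f) b → ∀ z,
      ∫ ω, sincInv (k * dist b (f ω)) * cos (k * dist z (f ω)) ∂ν ≤
        cos (k * dist b z) * ∫ ω, sincInv (k * dist b (f ω)) * cos (k * dist b (f ω)) ∂ν := by
    intro f b hfm hb z
    have := Measure.isProbabilityMeasure_map (μ := ν) hfm.aemeasurable
    have h := hY.firstVariation hk hd' (ν.map f) hb z
    rwa [integral_map hfm.aemeasurable (hgm b z).aestronglyMeasurable,
      integral_map hfm.aemeasurable (hgm b b).aestronglyMeasurable] at h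
  have hint : ∀ {g : Ω → ℝ}, Measurable g → ∀ C, (∀ ω, 0 ≤ g ω) → (∀ ω, g ω ≤ C) →
      Integrable g ν := fun hg C h0 h1 =>
    Integrable.of_bound hg.aestronglyMeasurable C
      (Eventually.of_forall fun ω => by rw [norm_of_nonneg (h0 ω)]; exact h1 ω)
  have iw : ∀ (f : Ω → Y) (b : Y), Measurable f →
      Integrable (fun ω => sincInv (k * dist b (f ω))) ν := fun f b hfm =>
    hint ((measurable_sincInv.comp (hmd b)).comp hfm) M
      (fun ω => zero_le_one.trans (hw1 _ _)) (fun ω => hwM _ _)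
  have iwc : ∀ (f : Ω → Y) (b z : Y), Measurable f →
      Integrable (fun ω => sincInv (k * dist b (f ω)) * cos (k * dist z (f ω))) ν :=
    fun f b z hfm => hint ((hgm b z).comp hfm) (M * 1)
      (fun ω => mul_nonneg (zero_le_one.trans (hw1 _ _)) (hcos _ _))
      (fun ω => mul_le_mul (hwM _ _) (cos_le_one _) (hcos _ _) (zero_le_one.trans hM1))
  -- testing with the center `o` bounds the radial averages from below
  have center : ∀ (f : Ω → Y) (b : Y), Measurable f → IsBarycenter (ν.map f) b →
      cos (a / 2) * ∫ ω, sincInv (k * dist b (f ω)) ∂ν ≤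
        ∫ ω, sincInv (k * dist b (f ω)) * cos (k * dist b (f ω)) ∂ν := by
    intro f b hfm hb
    have h1 := fv f b hfm hb o
    have h2 : cos (a / 2) * ∫ ω, sincInv (k * dist b (f ω)) ∂ν ≤
        ∫ ω, sincInv (k * dist b (f ω)) * cos (k * dist o (f ω)) ∂ν := by
      rw [← integral_const_mul]
      refine integral_mono ((iw f b hfm).const_mul _) (iwc f b o hfm) fun ω => ?_
      have : cos (a / 2) ≤ cos (k * dist o (f ω)) :=
        cos_le_cos_of_nonneg_of_le_pi (hmem _ _).1 (by linarith [pi_pos]) (ho _)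
      simp only
      rw [mul_comm]
      exact mul_le_mul_of_nonneg_left this (zero_le_one.trans (hw1 _ _))
    have h3 : 0 ≤ ∫ ω, sincInv (k * dist b (f ω)) * cos (k * dist b (f ω)) ∂ν :=
      integral_nonneg fun ω => mul_nonneg (zero_le_one.trans (hw1 _ _)) (hcos _ _)
    nlinarith [cos_le_one (k * dist b o)]
  have hE := fv f₁ b₁ hf₁ hb₁ b₂
  have hF := fv f₂ b₂ hf₂ hb₂ b₁
  rw [dist_comm b₂ b₁] at hF
  have cA := center f₁ b₁ hf₁ hb₁
  have cB := center f₂ b₂ hf₂ hb₂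
  have is := iw f₁ b₁ hf₁
  have it := iw f₂ b₂ hf₂
  have iA := iwc f₁ b₁ b₁ hf₁
  have iB := iwc f₂ b₂ b₂ hf₂
  have iE := iwc f₁ b₁ b₂ hf₁
  have iF := iwc f₂ b₂ b₁ hf₂
  have iP : Integrable (fun ω => sincInv (k * dist b₁ (f₁ ω)) * sincInv (k * dist b₂ (f₂ ω))) ν :=
    hint (((measurable_sincInv.comp (hmd b₁)).comp hf₁).mul
      ((measurable_sincInv.comp (hmd b₂)).comp hf₂)) (M * M)
      (fun ω => mul_nonneg (zero_le_one.trans (hw1 _ _)) (zero_le_one.trans (hw1 _ _)))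
      (fun ω => mul_le_mul (hwM _ _) (hwM _ _) (zero_le_one.trans (hw1 _ _))
        (zero_le_one.trans hM1))
  have iV : Integrable (fun ω => 2 - 2 * cos (k * dist (f₁ ω) (f₂ ω))) ν :=
    hint (((measurable_cos.comp (hf.const_mul k)).const_mul 2).const_sub 2) 2
      (fun ω => by linarith [cos_le_one (k * dist (f₁ ω) (f₂ ω))])
      (fun ω => by linarith [hcos (f₁ ω) (f₂ ω)])
  have hs1 : 1 ≤ ∫ ω, sincInv (k * dist b₁ (f₁ ω)) ∂ν := by
    simpa using integral_mono (integrable_const (1 : ℝ)) is fun ω => hw1 _ _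
  have ht1 : 1 ≤ ∫ ω, sincInv (k * dist b₂ (f₂ ω)) ∂ν := by
    simpa using integral_mono (integrable_const (1 : ℝ)) it fun ω => hw1 _ _
  have hP := integral_mono (iP.const_mul 2) (((is.add it).const_mul (1 + M)).sub
    (integrable_const (2 * M))) fun ω => by
      have h1 := hw1 b₁ (f₁ ω)
      have h2 := hw1 b₂ (f₂ ω)
      have h3 := hwM b₁ (f₁ ω)
      have h4 := hwM b₂ (f₂ ω)
      simp only [Pi.add_apply, Pi.sub_apply]
      nlinarith [mul_nonneg (sub_nonneg.2 h1) (sub_nonneg.2 h4),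
        mul_nonneg (sub_nonneg.2 h2) (sub_nonneg.2 h3)]
  rw [integral_const_mul, integral_sub' ((is.add it).const_mul (1 + M)) (integrable_const _),
    integral_const_mul, integral_add' is it, integral_const, probReal_univ, one_smul] at hP
  -- this makes the parameter `θ` chosen below at most `1`
  have hSP := integral_mono (iA.add iB) (iP.const_mul 2) fun ω => by
      have h1 := hw1 b₁ (f₁ ω)
      have h2 := hw1 b₂ (f₂ ω)
      simp only [Pi.add_apply]
      nlinarith [cos_le_one (k * dist b₁ (f₁ ω)), cos_le_one (k * dist b₂ (f₂ ω))]
  rw [integral_const_mul, integral_add' iA iB] at hSP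
  -- The integrated quadrilateral inequality: the term `(t - s) ^ 2` on its right side is absorbed by
  -- `(t - s) * (cos ρ₁ - cos ρ₂)`, which appears when `t * cos ρ₁ + s * cos ρ₂` is rewritten with
  -- the weights exchanged.
  have hquad : ∀ θ : ℝ, 0 < θ → θ ≤ 1 → _ := fun θ hθ hθ1 =>
    integral_mono ((iA.add iB).sub (iE.add iF)) ((iV.const_mul (1 / (4 * θ))).add
      (iP.const_mul (θ * (2 - 2 * cos (k * dist b₁ b₂))))) fun ω => by
      have q := hY.quadrilateral hk.le hd' (f₁ ω) (f₂ ω) b₁ b₂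
        (zero_lt_one.trans_le (hw1 b₁ (f₁ ω))) (zero_lt_one.trans_le (hw1 b₂ (f₂ ω)))
        (by positivity : 0 < 1 / (2 * θ))
      have m := sq_sincInv_sub_le (hmem b₁ (f₁ ω)) (hmem b₂ (f₂ ω))
      rw [div_div_eq_mul_div, div_one] at q
      simp only [Pi.add_apply, Pi.sub_apply]
      have e : 1 / (4 * θ) * (2 - 2 * cos (k * dist (f₁ ω) (f₂ ω))) =
          1 / (2 * θ) * (2 - 2 * cos (k * dist (f₁ ω) (f₂ ω))) / 2 := by field_simp; norm_num
      rw [e]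
      nlinarith [mul_le_of_le_one_left (sq_nonneg
        (sincInv (k * dist b₂ (f₂ ω)) - sincInv (k * dist b₁ (f₁ ω)))) hθ1]
  have hV0 : 0 ≤ ∫ ω, (2 - 2 * cos (k * dist (f₁ ω) (f₂ ω))) ∂ν :=
    integral_nonneg fun ω => by
      simp only [Pi.zero_apply]; linarith [cos_le_one (k * dist (f₁ ω) (f₂ ω))]
  simp only [integral_sub' (iA.add iB) (iE.add iF), integral_add' iA iB, integral_add' iE iF] at hquad
  set s := ∫ ω, sincInv (k * dist b₁ (f₁ ω)) ∂ν
  set t := ∫ ω, sincInv (k * dist b₂ (f₂ ω)) ∂ν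
  set A := ∫ ω, sincInv (k * dist b₁ (f₁ ω)) * cos (k * dist b₁ (f₁ ω)) ∂ν
  set B := ∫ ω, sincInv (k * dist b₂ (f₂ ω)) * cos (k * dist b₂ (f₂ ω)) ∂ν
  set E := ∫ ω, sincInv (k * dist b₁ (f₁ ω)) * cos (k * dist b₂ (f₁ ω)) ∂ν
  set F := ∫ ω, sincInv (k * dist b₂ (f₂ ω)) * cos (k * dist b₁ (f₂ ω)) ∂ν
  have hS0 : 0 < (A + B) / 2 := by nlinarith [mul_pos hR (by linarith : 0 < s + t)]
  have hP0 : 0 < ∫ ω, sincInv (k * dist b₁ (f₁ ω)) * sincInv (k * dist b₂ (f₂ ω)) ∂ν := by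
    linarith
  refine chord_sq_le_of_estimates (S := (A + B) / 2) (m := (s + t) / 2) hc hR.le
    ?_ hM1 hMc hV0 (by linarith [cos_le_one (k * dist b₁ b₂)]) (by linarith) (by linarith)
    (P := ∫ ω, sincInv (k * dist b₁ (f₁ ω)) * sincInv (k * dist b₂ (f₂ ω)) ∂ν) (by linarith) ?_
  · have := cos_sq (a / 2)
    rw [show 2 * (a / 2) = a by ring] at this
    rw [this]; ring
  · -- `θ = S / (2 P)` balances the two error terms
    have hq := hquad ((A + B) / 2 / (2 * ∫ ω, sincInv (k * dist b₁ (f₁ ω)) *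
      sincInv (k * dist b₂ (f₂ ω)) ∂ν)) (by positivity)
      (by rw [div_le_one (by positivity)]; linarith)
    rw [integral_add' (iV.const_mul _) (iP.const_mul _), integral_const_mul, integral_const_mul] at hq
    set P := ∫ ω, sincInv (k * dist b₁ (f₁ ω)) * sincInv (k * dist b₂ (f₂ ω)) ∂ν
    set V := ∫ ω, (2 - 2 * cos (k * dist (f₁ ω) (f₂ ω))) ∂ν
    set S := (A + B) / 2 with hS
    set q := 2 - 2 * cos (k * dist b₁ b₂) with hqdef
    have hcD : cos (k * dist b₁ b₂) = 1 - q / 2 := by rw [hqdef]; ring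
    have h1 : S * q ≤ 1 / (4 * (S / (2 * P))) * V + S / (2 * P) * q * P := by
      rw [hcD] at hE hF
      have : S * q = q / 2 * A + q / 2 * B := by rw [hS]; ring
      linarith
    have h2 : 1 / (4 * (S / (2 * P))) * V + S / (2 * P) * q * P =
        (V * P / S + S * q) / 2 := by field_simp; ring
    rw [h2] at h1
    have h3 : S * q ≤ V * P / S := by linarith
    rw [le_div_iff₀ hS0] at h3
    linarith

theorem Gam_sq {ε : ℝ} (hε0 : 0 < ε) (hε1 : ε < 1) :
    0 < Gam ε ∧ Gam ε ^ 2 = π ^ 2 / 8 / √(cos ((1 - ε) * (π / 2))) := by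
  have hc : 0 < cos ((1 - ε) * (π / 2)) :=
    cos_pos_of_mem_Ioo ⟨by nlinarith [pi_pos], by nlinarith [pi_pos]⟩
  refine ⟨by unfold Gam; positivity, ?_⟩
  have h4 : (cos ((1 - ε) * (π / 2)) ^ (1 / 4 : ℝ)) ^ 2 = √(cos ((1 - ε) * (π / 2))) := by
    rw [sqrt_eq_rpow, ← rpow_natCast, ← rpow_mul hc.le]; norm_num
  rw [Gam, div_pow, mul_pow, h4, mul_pow, sq_sqrt (by norm_num), div_div]
  norm_num

/-- The Lipschitz estimate for one coupling, in the normalization of the Wasserstein distance. -/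
theorem HasConeCombinations.edist_le {k ε : ℝ} (hε0 : 0 < ε) (hε1 : ε < 1)
    (hY : HasConeCombinations k Y) (hk : 0 < k) (o : Y)
    (ho : ∀ x : Y, k * dist o x ≤ (1 - ε) * (π / 2) / 2)
    {Ω : Type*} [MeasurableSpace Ω] (ν : Measure Ω) [IsProbabilityMeasure ν] {f₁ f₂ : Ω → Y}
    (hf₁ : Measurable f₁) (hf₂ : Measurable f₂) (hf : Measurable fun ω => dist (f₁ ω) (f₂ ω))
    {b₁ b₂ : Y} (hb₁ : IsBarycenter (ν.map f₁) b₁) (hb₂ : IsBarycenter (ν.map f₂) b₂) :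
    edist b₁ b₂ ≤
      ENNReal.ofReal (Gam ε) * (∫⁻ ω, edist (f₁ ω) (f₂ ω) ^ 2 ∂ν) ^ (1 / 2 : ℝ) := by
  obtain ⟨hG, hG2⟩ := Gam_sq hε0 hε1
  have ha : (1 - ε) * (π / 2) < π / 2 := by nlinarith [pi_pos]
  set a := (1 - ε) * (π / 2)
  have hd : ∀ p q : Y, k * dist p q ≤ π / 2 := fun p q => by
    have := mul_le_mul_of_nonneg_left (dist_triangle_left p q o) hk.le
    linarith [ho p, ho q]
  have hi : Integrable (fun ω => dist (f₁ ω) (f₂ ω) ^ 2) ν := by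
    refine Integrable.of_bound (hf.pow_const 2).aestronglyMeasurable ((π / 2 / k) ^ 2)
      (Eventually.of_forall fun ω => ?_)
    rw [norm_of_nonneg (by positivity)]
    refine pow_le_pow_left₀ dist_nonneg ?_ 2
    rw [le_div_iff₀ hk, mul_comm]; exact hd _ _
  have hV : ∫ ω, (2 - 2 * cos (k * dist (f₁ ω) (f₂ ω))) ∂ν ≤
      k ^ 2 * ∫ ω, dist (f₁ ω) (f₂ ω) ^ 2 ∂ν := by
    rw [← integral_const_mul]
    refine integral_mono_of_nonneg (Eventually.of_forall fun ω => ?_) (hi.const_mul _)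
      (Eventually.of_forall fun ω => ?_)
    · simp only [Pi.zero_apply]; linarith [cos_le_one (k * dist (f₁ ω) (f₂ ω))]
    · simp only
      rw [← mul_pow]; linarith [one_sub_sq_div_two_le_cos (x := k * dist (f₁ ω) (f₂ ω))]
  have hq := hY.chord_sq_le hk ha o ho ν hf₁ hf₂ hf hb₁ hb₂
  have hD := sq_le_chord_sq (mul_nonneg hk.le dist_nonneg) (hd b₁ b₂)
  set W := ∫ ω, dist (f₁ ω) (f₂ ω) ^ 2 ∂ν with hW
  have hW0 : 0 ≤ W := integral_nonneg fun ω => by positivity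
  have hsq : dist b₁ b₂ ^ 2 ≤ Gam ε ^ 2 * W := by
    refine le_of_mul_le_mul_left ?_ (pow_pos hk 2)
    calc k ^ 2 * dist b₁ b₂ ^ 2 = (k * dist b₁ b₂) ^ 2 := by ring
      _ ≤ π ^ 2 / 8 * (k ^ 2 * W / √(cos a)) := hD.trans (by gcongr; exact hq.trans (by gcongr))
      _ = k ^ 2 * (Gam ε ^ 2 * W) := by rw [hG2]; ring
  have hdist : dist b₁ b₂ ≤ Gam ε * √W := by
    refine le_of_sq_le_sq ?_ (by positivity)
    rwa [mul_pow, sq_sqrt hW0]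
  have hL : ∫⁻ ω, edist (f₁ ω) (f₂ ω) ^ 2 ∂ν = ENNReal.ofReal W := by
    rw [hW, ofReal_integral_eq_lintegral_ofReal hi (Eventually.of_forall fun ω => by positivity)]
    simp only [edist_dist, ENNReal.ofReal_pow dist_nonneg]
  rw [hL, ENNReal.ofReal_rpow_of_nonneg hW0 (by norm_num), ← sqrt_eq_rpow,
    ← ENNReal.ofReal_mul hG.le, edist_dist]
  exact ENNReal.ofReal_le_ofReal hdist

end Measure

end BarycenterContraction

open Real in
theorem mainTheorem4 (ε : ℝ) (hε0 : 0 < ε) (hε1 : ε < 1) :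
    0 < Gam ε ∧
    ∀ (κ : ℝ) (_ : 0 < κ) (X : Type*) [MetricSpace X] [CompleteSpace X]
      [MeasurableSpace X] [BorelSpace X] (_ : IsCAT κ X)
      (o : X) (r : ℝ) (_ : r ≤ (1 - ε) * modelDiam κ / 4),
      (∀ μ : Measure (Metric.closedBall o r), MemP2 μ → ∃! b, IsBarycenter μ b) ∧
      ∀ μ₁ μ₂ : Measure (Metric.closedBall o r), MemP2 μ₁ → MemP2 μ₂ →
        ∀ b₁ b₂ : Metric.closedBall o r, IsBarycenter μ₁ b₁ → IsBarycenter μ₂ b₂ →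
          edist b₁ b₂ ≤ ENNReal.ofReal (Gam ε) * W2 μ₁ μ₂ := by
  obtain ⟨hG, -⟩ := Gam_sq hε0 hε1
  refine ⟨hG, ?_⟩
  intro κ hκ X _ _ _ _ hX o r hr
  have hk : 0 < √κ := sqrt_pos.2 hκ
  have hkr : √κ * r ≤ (1 - ε) * (π / 2) / 2 := by
    calc √κ * r ≤ √κ * ((1 - ε) * modelDiam κ / 4) := by gcongr
      _ = (1 - ε) * (π / 2) / 2 := by rw [modelDiam]; field_simp; norm_num
  have ha : (1 - ε) * (π / 2) < π / 2 := by nlinarith [pi_pos]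
  have hY := hX.hasConeCombinations_closedBall hκ o (r := r) (by linarith)
  have hox : ∀ x : Metric.closedBall o r, √κ * dist o (x : X) ≤ (1 - ε) * (π / 2) / 2 :=
    fun x => hkr.trans' (by gcongr; rw [dist_comm]; exact x.2)
  refine ⟨fun μ hμ => ?_, fun μ₁ μ₂ hμ₁ hμ₂ b₁ b₂ hb₁ hb₂ => ?_⟩
  · have := hμ.1
    have : CompleteSpace (Metric.closedBall o r) := Metric.isClosed_closedBall.completeSpace_coe
    refine hY.existsUnique_isBarycenter hk ha (fun p q => ?_) μ
    have := mul_le_mul_of_nonneg_left (dist_triangle_left (p : X) q o) hk.le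
    rw [Subtype.dist_eq]
    linarith [hox p, hox q]
  · -- each coupling is treated on the product space with its Borel σ-algebra
    have hμ := hμ₁.1
    have hr0 : 0 ≤ r := dist_nonneg.trans b₁.2
    rw [W2, ENNReal.mul_iInf_of_ne (by simpa using hG) ENNReal.ofReal_ne_top]
    refine le_iInf fun ν => ?_
    rw [ENNReal.mul_iInf_of_ne (by simpa using hG) ENNReal.ofReal_ne_top]
    refine le_iInf fun hν => ?_
    let _ : MeasurableSpace (Metric.closedBall o r × Metric.closedBall o r) := borel _
    have : BorelSpace (Metric.closedBall o r × Metric.closedBall o r) := ⟨rfl⟩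
    have h1 : Measurable (Prod.fst : Metric.closedBall o r × Metric.closedBall o r → _) :=
      continuous_fst.measurable
    have h2 : Measurable (Prod.snd : Metric.closedBall o r × Metric.closedBall o r → _) :=
      continuous_snd.measurable
    have hd : Measurable fun q : Metric.closedBall o r × Metric.closedBall o r =>
        dist q.1 q.2 := continuous_dist.measurable
    have hp : IsProbabilityMeasure ν := by
      rw [← hν.1] at hμ
      exact Measure.isProbabilityMeasure_of_map Prod.fst
    rw [← hν.1] at hb₁
    rw [← hν.2] at hb₂
    exact hY.edist_le hε0 hε1 hk ⟨o, Metric.mem_closedBall_self hr0⟩ hox ν h1 h2 hd hb₁ hb₂
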